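/- Let $G$ be a group and $n$ a natural number. Let $\mathrm{Rep}_n(G)$ be the scheme over $\mathbb{Z}$ representing the functor that sends a scheme $X$ to the set of group homomorphisms $G \to \mathrm{GL}_n(\Gamma(X,\mathcal{O}_X))$, and for a point $x \in \mathrm{Rep}_n(G)$ with residue field $k(x)$ let $\rho_x : G \to \mathrm{GL}_n(k(x))$ be the representation induced by the universal one. A representation $\rho : G \to \mathrm{GL}(V)$ on a finite-dimensional vector space $V$ over a field $k$ is called $m$-thick if for all subspaces $V_1, V_2 \subseteq V$ with $\dim V_1 = m$ and $\dim V_2 = \dim V - m$ there exists $g \in G$ with $(\rho(g)V_1) \oplus V_2 = V$; it is called absolutely $m$-thick if $\rho \otimes_k \overline{k}$ is $m$-thick for an algebraic closure $\overline{k}$ of $k$, and absolutely thick if it is absolutely $m$-thick for every $0 < m < \dim V$. For every $0 < m < n$, the set of points $x \in \mathrm{Rep}_n(G)$ such that $\rho_x$ is absolutely $m$-thick is (the underlying set of) an open subscheme of $\mathrm{Rep}_n(G)$. In particular, the set of points $x \in \mathrm{Rep}_n(G)$ such that $\rho_x$ is absolutely thick is an open subscheme of $\mathrm{Rep}_n(G)$.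 -/

import Mathlib

open CategoryTheory AlgebraicGeometry Opposite
open scoped TensorProduct

universe u

noncomputable section

/-! ### Thick representations over a field -/

namespace Representation

section Thick

variable {k G V : Type*} [Field k] [Group G] [AddCommGroup V] [Module k V]

/-- A finite-dimensional representation `V` of `G` is `m`-thick if for all subspaces `V₁`, `V₂`
of dimensions `m` and `dim V - m` there is `g ∈ G` with `(ρ(g) V₁) ⊕ V₂ = V`. -/
def IsMThick [FiniteDimensional k V] (ρ : Representation k G V) (m : ℕ) : Prop :=
  ∀ V₁ V₂ : Submodule k V, Module.finrank k V₁ = m →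
    m + Module.finrank k V₂ = Module.finrank k V → ∃ g : G, IsCompl (V₁.map (ρ g)) V₂

/-- The extension of scalars `ρ ⊗ K` of a representation `ρ` along a field extension `K / k`. -/
def extendScalars (ρ : Representation k G V) (K : Type*) [Field K] [Algebra k K] :
    Representation K G (K ⊗[k] V) where
  toFun g := (ρ g).baseChange K
  map_one' := by rw [map_one]; exact LinearMap.baseChange_one k V
  map_mul' g h := by rw [map_mul]; exact LinearMap.baseChange_mul (ρ g) (ρ h)

/-- `ρ` is absolutely `m`-thick if it is `m`-thick over an algebraic closure of the base field. -/
def IsAbsMThick [FiniteDimensional k V] (ρ : Representation k G V) (m : ℕ) : Prop :=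
  (ρ.extendScalars (AlgebraicClosure k)).IsMThick m

/-- `ρ` is absolutely thick if it is absolutely `m`-thick for each `0 < m < dim V`. -/
def IsAbsThick [FiniteDimensional k V] (ρ : Representation k G V) : Prop :=
  ∀ m : ℕ, 0 < m → m < Module.finrank k V → ρ.IsAbsMThick m

end Thick

end Representation

/-! ### The representation scheme -/

namespace RepScheme

variable (n : ℕ) (G : Type u) [Group G]

/-- The functor `X ↦ {group homomorphisms G → GL_n(Γ(X, O_X))}` on schemes. -/
def repFunctor : Scheme.{u}ᵒᵖ ⥤ Type u where
  obj X := G →* Matrix.GeneralLinearGroup (Fin n) Γ(X.unop, ⊤)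
  map f := ↾fun ρ => (Matrix.GeneralLinearGroup.map f.unop.appTop.hom).comp ρ

/-- The generic `n × n` matrix attached to `g ∈ G`. -/
def genericMatrix (g : G) : Matrix (Fin n) (Fin n) (MvPolynomial (G × Fin n × Fin n) ℤ) :=
  Matrix.of fun i j => MvPolynomial.X (g, i, j)

/-- The ideal generated by the entries of the matrix relations `X(1) = 1` and
`X(gh) = X(g) X(h)`. -/
def relations : Ideal (MvPolynomial (G × Fin n × Fin n) ℤ) :=
  Ideal.span
    ({p | ∃ i j, p = (genericMatrix n G 1 - 1) i j} ∪
      {p | ∃ g h i j, p = (genericMatrix n G (g * h) -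
        genericMatrix n G g * genericMatrix n G h) i j})

/-- The coordinate ring of the representation scheme over `ℤ`. -/
abbrev coordRing : Type u := MvPolynomial (G × Fin n × Fin n) ℤ ⧸ relations n G

/-- The universal matrices over the coordinate ring. -/
def universalMatrix : G →* Matrix (Fin n) (Fin n) (coordRing n G) where
  toFun g := (genericMatrix n G g).map (Ideal.Quotient.mk (relations n G))
  map_one' := by
    ext i j
    have h : (genericMatrix n G 1 - 1) i j ∈ relations n G :=
      Ideal.subset_span (Or.inl ⟨i, j, rfl⟩)
    rw [Matrix.sub_apply, ← Ideal.Quotient.eq] at h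
    rw [Matrix.map_apply, h, Matrix.one_apply, Matrix.one_apply]
    split_ifs <;> simp
  map_mul' g h := by
    rw [← Matrix.map_mul]
    ext i j
    have h : (genericMatrix n G (g * h) - genericMatrix n G g * genericMatrix n G h) i j ∈
        relations n G := Ideal.subset_span (Or.inr ⟨g, h, i, j, rfl⟩)
    rw [Matrix.sub_apply, ← Ideal.Quotient.eq] at h
    exact h

/-- The universal representation over the coordinate ring. -/
def universalRing : G →* Matrix.GeneralLinearGroup (Fin n) (coordRing n G) :=
  (universalMatrix n G).toHomUnits

variable {n G} in
/-- The ring homomorphism out of the coordinate ring that classifies a representation. -/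
def classify {R : Type*} [CommRing R] (ρ : G →* Matrix.GeneralLinearGroup (Fin n) R) :
    coordRing n G →+* R :=
  Ideal.Quotient.lift (relations n G)
    (MvPolynomial.eval₂Hom (Int.castRingHom R) fun t => (ρ t.1 : Matrix (Fin n) (Fin n) R) t.2.1 t.2.2)
    (by
      set e := MvPolynomial.eval₂Hom (Int.castRingHom R)
        fun t : G × Fin n × Fin n => (ρ t.1 : Matrix (Fin n) (Fin n) R) t.2.1 t.2.2 with he
      have key : ∀ g i j, e (genericMatrix n G g i j) = (ρ g : Matrix (Fin n) (Fin n) R) i j := by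
        intro g i j
        simp [he, genericMatrix]
      intro a ha
      change a ∈ RingHom.ker e
      refine (Ideal.span_le.mpr ?_ : relations n G ≤ RingHom.ker e) ha
      rintro p (⟨i, j, rfl⟩ | ⟨g, h, i, j, rfl⟩)
      · change e _ = 0
        rw [Matrix.sub_apply, map_sub, key, map_one, Matrix.one_apply]
        split_ifs with hij <;> simp [hij]
      · change e _ = 0
        rw [Matrix.sub_apply, map_sub, key, Matrix.mul_apply, map_sum, map_mul]
        simp [key, Matrix.mul_apply])

/-- Ring homomorphisms out of the coordinate ring are the same as representations. -/
def ringHomEquiv (R : Type*) [CommRing R] :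
    (coordRing n G →+* R) ≃ (G →* Matrix.GeneralLinearGroup (Fin n) R) where
  toFun f := (Matrix.GeneralLinearGroup.map f).comp (universalRing n G)
  invFun ρ := classify ρ
  left_inv f := by
    apply Ideal.Quotient.ringHom_ext
    apply MvPolynomial.ringHom_ext
    · intro r
      simp
    · rintro ⟨g, i, j⟩
      simp [classify, universalRing, universalMatrix, genericMatrix]
  right_inv ρ := by
    ext g i j
    simp [classify, universalRing, universalMatrix, genericMatrix]

end RepScheme

open RepScheme

/-- The representation scheme `Rep_n(G)` over `ℤ`. -/
abbrev RepScheme (n : ℕ) (G : Type u) [Group G] : Scheme.{u} :=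
  Spec (CommRingCat.of (coordRing n G))

namespace RepScheme

variable (n : ℕ) (G : Type u) [Group G]

/-- The universal representation `G → GL_n(Γ(Rep_n(G), O))`. -/
def universal : G →* Matrix.GeneralLinearGroup (Fin n) Γ(RepScheme n G, ⊤) :=
  (Matrix.GeneralLinearGroup.map
    (Scheme.ΓSpecIso (CommRingCat.of (coordRing n G))).inv.hom).comp (universalRing n G)

/-- Morphisms `X ⟶ Rep_n(G)` correspond to representations `G → GL_n(Γ(X, O_X))`, by pulling back
the universal representation. -/
def homEquiv (X : Scheme.{u}) :
    (X ⟶ RepScheme n G) ≃ (G →* Matrix.GeneralLinearGroup (Fin n) Γ(X, ⊤)) where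
  toFun f := (Matrix.GeneralLinearGroup.map f.appTop.hom).comp (universal n G)
  invFun ρ := X.toSpecΓ ≫ Spec.map (CommRingCat.ofHom (classify ρ))
  left_inv f := by
    apply (ΓSpec.adjunction.homEquiv X (op (CommRingCat.of (coordRing n G)))).symm.injective
    apply Quiver.Hom.unop_inj
    rw [Adjunction.homEquiv_symm_apply, Adjunction.homEquiv_symm_apply]
    dsimp
    simp only [Scheme.toSpecΓ_appTop, Scheme.ΓSpecIso_naturality, Iso.inv_hom_id_assoc]
    ext1
    exact (ringHomEquiv n G _).left_inv
      ((Scheme.ΓSpecIso (CommRingCat.of (coordRing n G))).inv ≫ f.appTop).hom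
  right_inv ρ := by
    have h : (Scheme.ΓSpecIso (CommRingCat.of (coordRing n G))).inv ≫
        (X.toSpecΓ ≫ Spec.map (CommRingCat.ofHom (classify ρ))).appTop =
          CommRingCat.ofHom (classify ρ) := by
      simp
    refine Eq.trans ?_ ((ringHomEquiv n G Γ(X, ⊤)).right_inv ρ)
    change _ = (Matrix.GeneralLinearGroup.map (CommRingCat.ofHom (classify ρ)).hom).comp _
    rw [← h]
    rfl

/-- `Rep_n(G)` represents the functor of `n`-dimensional representations of `G`. -/
def representableBy : (repFunctor n G).RepresentableBy (RepScheme n G) where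
  homEquiv {X} := homEquiv n G X
  homEquiv_comp f g := by
    refine MonoidHom.ext fun γ => Matrix.GeneralLinearGroup.ext fun i j => ?_
    change (f ≫ g).appTop.hom ((universal n G γ : Matrix _ _ _) i j) =
      f.appTop.hom (g.appTop.hom ((universal n G γ : Matrix _ _ _) i j))
    rw [Scheme.Hom.comp_appTop]
    rfl

theorem homEquiv_id : (representableBy n G).homEquiv (𝟙 (RepScheme n G)) = universal n G := by
  refine MonoidHom.ext fun γ => Matrix.GeneralLinearGroup.ext fun i j => ?_
  rfl

variable {n G} in
/-- The fibre at a point `x` of a representation `G → GL_n(Γ(X, O_X))` on a scheme `X`: the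
induced representation `G → GL_n(κ(x))` over the residue field. -/
def fibre {X : Scheme.{u}} (ρ : G →* Matrix.GeneralLinearGroup (Fin n) Γ(X, ⊤)) (x : X) :
    Representation (X.residueField x) G (Fin n → X.residueField x) where
  toFun g := Matrix.toLin'
    (Matrix.GeneralLinearGroup.map (X.Γevaluation x).hom (ρ g) :
      Matrix (Fin n) (Fin n) (X.residueField x))
  map_one' := by rw [map_one, map_one]; exact Matrix.toLin'_one
  map_mul' g h := by rw [map_mul, map_mul]; exact Matrix.toLin'_mul _ _

end RepScheme

end

/-! The complement is closed because it is the image of a closed subset of a product of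
Grassmannians, and Grassmannians are proper. In bases, a pair of subspaces violating thickness is a
pair of matrices `A`, `B` with left inverses `C`, `D` and `det [M g A | B] = 0` for all `g`. These
equations make sense over any ring and are represented by the algebra `ObstructionRing`, of finite
type over the base. By the Nullstellensatz, the image of its spectrum is exactly the locus that is
not absolutely `m`-thick (`mem_range_comap_obstructionRing_iff`). The image of a map of spectra is
closed once it is stable under specialization. A specialization is realized by a valuation ring,
over which an obstruction on the fraction field extends after a change of bases
(`isObstructed_valuationSubring`) and can then be reduced to the residue field. -/

noncomputable section

namespace Matrix

variable {ι α β G : Type*} [Fintype ι] [Fintype α] [DecidableEq α]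
  [Fintype β] [DecidableEq β]

/-! ### Obstructions to thickness as determinantal equations. -/

section Pairing

variable {R T : Type*} [CommRing R] [CommRing T]

/-- The determinant of the square matrix `[M A | B]`, whose vanishing says that the column space
of `B` is not a complement of the one of `M A`. -/
def pairingDet (e : α ⊕ β ≃ ι) (M : Matrix ι ι R) (A : Matrix ι α R) (B : Matrix ι β R) : R :=
  ((fromCols (M * A) B).submatrix e id).det

theorem pairingDet_map (e : α ⊕ β ≃ ι) (M : Matrix ι ι R) (A : Matrix ι α R) (B : Matrix ι β R)
    (f : R →+* T) : pairingDet e (M.map f) (A.map f) (B.map f) = f (pairingDet e M A B) := by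
  rw [pairingDet, pairingDet, RingHom.map_det, ← Matrix.map_mul, ← fromCols_map]
  rfl

/-- A change of bases multiplies `[M A | B]` on the right by a block diagonal matrix, so the
vanishing of the determinant is inherited by the new bases. -/
theorem pairingDet_mul (e : α ⊕ β ≃ ι) (M : Matrix ι ι R) (A : Matrix ι α R) (B : Matrix ι β R)
    (U : Matrix α α R) (W : Matrix β β R) :
    pairingDet e M (A * U) (B * W) = pairingDet e M A B * (U.det * W.det) := by
  have h : fromCols (M * (A * U)) (B * W) = fromCols (M * A) B * fromBlocks U 0 0 W := by
    rw [fromCols_mul_fromBlocks]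
    simp [Matrix.mul_assoc]
  have h' : (fromCols (M * A) B * fromBlocks U 0 0 W).submatrix e id =
      (fromCols (M * A) B).submatrix e id * fromBlocks U 0 0 W := rfl
  rw [pairingDet, h, h', det_mul, det_fromBlocks_zero₂₁, pairingDet]

/-- A family of matrices `M g` over a ring is obstructed if there are two split injective
matrices `A` and `B` such that `[M g A | B]` has determinant zero for each `g`. -/
def IsObstructed (e : α ⊕ β ≃ ι) (M : G → Matrix ι ι R) : Prop :=
  ∃ (A : Matrix ι α R) (C : Matrix α ι R) (B : Matrix ι β R) (D : Matrix β ι R),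
    C * A = 1 ∧ D * B = 1 ∧ ∀ g, pairingDet e (M g) A B = 0

/-- Explicit left inverses turn split injectivity into equations, which any ring homomorphism
preserves. -/
theorem IsObstructed.map {e : α ⊕ β ≃ ι} {M : G → Matrix ι ι R} (h : IsObstructed e M)
    (f : R →+* T) : IsObstructed e fun g => (M g).map f := by
  obtain ⟨A, C, B, D, hA, hB, h⟩ := h
  refine ⟨A.map f, C.map f, B.map f, D.map f, ?_, ?_, fun g => ?_⟩
  · rw [← Matrix.map_mul, hA, Matrix.map_one f f.map_zero f.map_one]
  · rw [← Matrix.map_mul, hB, Matrix.map_one f f.map_zero f.map_one]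
  · rw [pairingDet_map, h, map_zero]

end Pairing

/-! ### The algebra representing obstructions. -/

section ObstructionRing

variable {R : Type*} [CommRing R]

/-- The index type of the entries of the four matrices of an obstruction. -/
abbrev ObstructionVars (ι α β : Type*) := ((ι × α) ⊕ (α × ι)) ⊕ ((ι × β) ⊕ (β × ι))

/-- The equations that define obstructions, as an ideal in the polynomial ring on the entries of
the four matrices. -/
def obstructionIdeal (e : α ⊕ β ≃ ι) (M : G → Matrix ι ι R) :
    Ideal (MvPolynomial (ObstructionVars ι α β) R) :=
  let A : Matrix ι α (MvPolynomial (ObstructionVars ι α β) R) :=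
    of fun i j => MvPolynomial.X (.inl (.inl (i, j)))
  let C : Matrix α ι (MvPolynomial (ObstructionVars ι α β) R) :=
    of fun i j => MvPolynomial.X (.inl (.inr (i, j)))
  let B : Matrix ι β (MvPolynomial (ObstructionVars ι α β) R) :=
    of fun i j => MvPolynomial.X (.inr (.inl (i, j)))
  let D : Matrix β ι (MvPolynomial (ObstructionVars ι α β) R) :=
    of fun i j => MvPolynomial.X (.inr (.inr (i, j)))
  Ideal.span ((Set.range fun t : α × α => (C * A) t.1 t.2 - (1 : Matrix α α _) t.1 t.2) ∪
    (Set.range fun t : β × β => (D * B) t.1 t.2 - (1 : Matrix β β _) t.1 t.2) ∪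
    Set.range fun g => pairingDet e ((M g).map MvPolynomial.C) A B)

/-- The `R`-algebra that represents obstructions of the family `M`. -/
abbrev ObstructionRing (e : α ⊕ β ≃ ι) (M : G → Matrix ι ι R) :=
  MvPolynomial (ObstructionVars ι α β) R ⧸ obstructionIdeal e M

theorem obstructionIdeal_le_ker_iff {T : Type*} [CommRing T] (e : α ⊕ β ≃ ι)
    (M : G → Matrix ι ι R) (φ : MvPolynomial (ObstructionVars ι α β) R →+* T) :
    obstructionIdeal e M ≤ RingHom.ker φ ↔
      (of fun i j => φ (.X (.inl (.inr (i, j))))) *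
        (of fun i j => φ (.X (.inl (.inl (i, j)))) : Matrix ι α T) = 1 ∧
      (of fun i j => φ (.X (.inr (.inr (i, j))))) *
        (of fun i j => φ (.X (.inr (.inl (i, j)))) : Matrix ι β T) = 1 ∧
      ∀ g, pairingDet e ((M g).map (φ.comp MvPolynomial.C))
        (of fun i j => φ (.X (.inl (.inl (i, j)))))
        (of fun i j => φ (.X (.inr (.inl (i, j))))) = 0 := by
  rw [obstructionIdeal, Ideal.span_le, Set.union_subset_iff, Set.union_subset_iff, and_assoc,
    Set.range_subset_iff, Set.range_subset_iff, Set.range_subset_iff]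
  refine and_congr ?_ (and_congr ?_ ?_)
  · rw [← Matrix.ext_iff, Prod.forall]
    refine forall_congr' fun i => forall_congr' fun j => ?_
    rw [SetLike.mem_coe, RingHom.mem_ker, map_sub, sub_eq_zero, one_apply, one_apply, apply_ite φ]
    simp [mul_apply]
  · rw [← Matrix.ext_iff, Prod.forall]
    refine forall_congr' fun i => forall_congr' fun j => ?_
    rw [SetLike.mem_coe, RingHom.mem_ker, map_sub, sub_eq_zero, one_apply, one_apply, apply_ite φ]
    simp [mul_apply]
  · refine forall_congr' fun g => ?_
    rw [SetLike.mem_coe, RingHom.mem_ker, ← pairingDet_map, Matrix.map_map]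
    rfl

/-- The universal property of `ObstructionRing`: an obstruction over `T` is a `T`-valued point lying
over `f`. -/
theorem isObstructed_map_iff {T : Type*} [CommRing T] (e : α ⊕ β ≃ ι)
    (M : G → Matrix ι ι R) (f : R →+* T) :
    IsObstructed e (fun g => (M g).map f) ↔
      ∃ φ : ObstructionRing e M →+* T, φ.comp (algebraMap R (ObstructionRing e M)) = f := by
  constructor
  · rintro ⟨A, C, B, D, hA, hB, h⟩
    let φ : MvPolynomial (ObstructionVars ι α β) R →+* T := MvPolynomial.eval₂Hom f
      (Sum.elim (Sum.elim (fun t => A t.1 t.2) fun t => C t.1 t.2)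
        (Sum.elim (fun t => B t.1 t.2) fun t => D t.1 t.2))
    have hφ : φ.comp MvPolynomial.C = f := RingHom.ext fun r => by simp [φ]
    have hle : obstructionIdeal e M ≤ RingHom.ker φ := by
      rw [obstructionIdeal_le_ker_iff, hφ]
      simp only [φ, MvPolynomial.coe_eval₂Hom, MvPolynomial.eval₂_X, Sum.elim_inl, Sum.elim_inr]
      exact ⟨hA, hB, h⟩
    exact ⟨Ideal.Quotient.lift _ φ hle, hφ⟩
  · rintro ⟨φ, rfl⟩
    have hle : obstructionIdeal e M ≤
        RingHom.ker (φ.comp (Ideal.Quotient.mk (obstructionIdeal e M))) := fun x hx => by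
      rw [RingHom.mem_ker, RingHom.comp_apply, Ideal.Quotient.eq_zero_iff_mem.mpr hx, map_zero]
    rw [obstructionIdeal_le_ker_iff] at hle
    exact ⟨_, _, _, _, hle⟩

end ObstructionRing

/-! ### Valuative criterion: extending obstructions over a valuation ring. -/

section Valuation

variable {L : Type*} [Field L]

/-- A weak Cauchy–Binet formula: multilinearity in the rows writes `det (C * A) = 1` as a
combination of the determinants of row selections of `A`. -/
theorem exists_det_submatrix_ne_zero {R : Type*} [CommRing R] [Nontrivial R] {A : Matrix ι α R}
    {C : Matrix α ι R} (h : C * A = 1) : ∃ s : α → ι, (A.submatrix s id).det ≠ 0 := by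
  by_contra! hs
  have h1 : (C * A).det = 0 := by
    have : C * A = fun k => ∑ i, C k i • A i := by
      ext k j
      simp [mul_apply]
    rw [this]
    change detRowAlternating.toMultilinearMap _ = 0
    rw [MultilinearMap.map_sum]
    refine Finset.sum_eq_zero fun s _ => ?_
    rw [MultilinearMap.map_smul_univ]
    exact smul_eq_zero_of_right _ (hs s)
  rw [h, det_one] at h1
  exact one_ne_zero h1

/-- The column space of a split injective matrix over the fraction field of a valuation ring
has a basis that is split injective over the valuation ring. -/
theorem exists_mul_eq_map_valuationSubring (O : ValuationSubring L) {A : Matrix ι α L}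
    {C : Matrix α ι L} (h : C * A = 1) :
    ∃ (U : Matrix α α L) (A' : Matrix ι α O) (C' : Matrix α ι O),
      A * U = A'.map O.subtype ∧ C' * A' = 1 := by
  classical
  obtain ⟨s₀, hs₀⟩ := exists_det_submatrix_ne_zero h
  have : Nonempty (α → ι) := ⟨s₀⟩
  -- Normalizing by the minor of largest valuation makes every quotient of a minor by it integral.
  obtain ⟨s, hs⟩ := Finite.exists_max fun s : α → ι => O.valuation (A.submatrix s id).det
  have hs1 : (A.submatrix s id).det ≠ 0 := fun h0 => by
    have := hs s₀
    rw [h0, map_zero, le_zero_iff, map_eq_zero] at this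
    exact hs₀ this
  set U := (A.submatrix s id)⁻¹ with hU
  have hAU : (A * U).submatrix s id = 1 := by
    have : (A * U).submatrix s id = A.submatrix s id * U := rfl
    rw [this, hU, mul_nonsing_inv _ (isUnit_iff_ne_zero.mpr hs1)]
  have hmem : ∀ i j, (A * U) i j ∈ O := by
    intro i j
    -- Cramer's rule: the rows `s` of `A * U` form the identity, so replacing the `j`-th of them by
    -- row `i` gives determinant `(A * U) i j`. This is a quotient of two minors of `A`.
    have h1 : (A * U) i j = ((A * U).submatrix (Function.update s j i) id).det := by
      have h2 : (A * U).submatrix (Function.update s j i) id =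
          (1 : Matrix α α L).updateRow j (∑ k, (A * U) i k • (1 : Matrix α α L) k) := by
        ext a b
        by_cases hab : a = j
        · subst hab
          simp [one_apply]
        · rw [submatrix_apply, Function.update_of_ne hab, updateRow_ne hab, ← hAU]
          rfl
      rw [h2, det_updateRow_sum, det_one, smul_eq_mul, mul_one]
    have h3 : (A * U).submatrix (Function.update s j i) id =
      A.submatrix (Function.update s j i) id * U := rfl
    rw [h1, h3, det_mul, hU, det_nonsing_inv, Ring.inverse_eq_inv, ← div_eq_mul_inv,
      ← O.valuation_le_one_iff, map_div₀]
    exact div_le_one_of_le₀ (hs _) zero_le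
  -- The left inverse merely selects the rows `s`.
  refine ⟨U, of fun i j => ⟨(A * U) i j, hmem i j⟩, (1 : Matrix ι ι O).submatrix s id, rfl, ?_⟩
  refine Matrix.map_injective O.subtype_injective ?_
  change Matrix.map _ O.subtype = Matrix.map _ O.subtype
  have h1 : (of fun i j => (⟨(A * U) i j, hmem i j⟩ : O)).map O.subtype = A * U := rfl
  have h2 : ((1 : Matrix ι ι O).submatrix s id).map O.subtype =
      ((1 : Matrix ι ι O).map O.subtype).submatrix s id := rfl
  have h3 : (1 : Matrix ι ι L).submatrix s id * (A * U) = (A * U).submatrix s id := by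
    simpa using Matrix.one_submatrix_mul s (Equiv.refl ι) (A * U)
  rw [Matrix.map_mul, h1, h2, Matrix.map_one _ (map_zero _) (map_one _),
    Matrix.map_one _ (map_zero _) (map_one _), h3, hAU]

theorem isObstructed_valuationSubring (O : ValuationSubring L) {e : α ⊕ β ≃ ι}
    {M : G → Matrix ι ι O} (h : IsObstructed e fun g => (M g).map O.subtype) :
    IsObstructed e M := by
  obtain ⟨A, C, B, D, hA, hB, h⟩ := h
  obtain ⟨U, A', C', hU, hA'⟩ := exists_mul_eq_map_valuationSubring O hA
  obtain ⟨W, B', D', hW, hB'⟩ := exists_mul_eq_map_valuationSubring O hB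
  refine ⟨A', C', B', D', hA', hB', fun g => O.subtype_injective ?_⟩
  rw [← pairingDet_map, ← hU, ← hW, pairingDet_mul, h, zero_mul, map_zero]

end Valuation

end Matrix

end

/-! ### Points over an algebraic closure. -/

/-- The weak Nullstellensatz, for points with values in an algebraic closure. -/
theorem Algebra.FiniteType.nonempty_algHom_algebraicClosure (K T : Type*) [Field K] [CommRing T]
    [Algebra K T] [Algebra.FiniteType K T] [Nontrivial T] :
    Nonempty (T →ₐ[K] AlgebraicClosure K) := by
  obtain ⟨m, hm⟩ := Ideal.exists_maximal T
  let := Ideal.Quotient.field m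
  have : Module.Finite K (T ⧸ m) := finite_of_finite_type_of_isJacobsonRing _ _
  let ψ : (T ⧸ m) →ₐ[K] AlgebraicClosure K := IsAlgClosed.lift
  exact ⟨ψ.comp (Ideal.Quotient.mkₐ K m)⟩

/-- A point of `Spec S` over the point `ker f` of `Spec R` yields a point of `Spec S` with values in
an algebraic closure of `K`, if `S` is of finite type over `R`. -/
theorem RingHom.exists_comp_eq_algebraicClosure {R S K : Type*} [CommRing R] [CommRing S]
    [Algebra R S] [Algebra.FiniteType R S] [Field K] (f : R →+* K) (q : Ideal S) [q.IsPrime]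
    (h : q.comap (algebraMap R S) = RingHom.ker f) :
    ∃ φ : S →+* AlgebraicClosure K,
      φ.comp (algebraMap R S) = (algebraMap K (AlgebraicClosure K)).comp f := by
  let toQ : R ⧸ RingHom.ker f →+* S ⧸ q :=
    Ideal.quotientMap q (algebraMap R S) h.ge
  have htoQ : toQ.comp (Ideal.Quotient.mk _) = (Ideal.Quotient.mk q).comp (algebraMap R S) := by
    ext; rfl
  let : Algebra (R ⧸ RingHom.ker f) K := (RingHom.kerLift f).toAlgebra
  let : Algebra (R ⧸ RingHom.ker f) (S ⧸ q) := toQ.toAlgebra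
  have hK : Function.Injective (algebraMap (R ⧸ RingHom.ker f) K) := RingHom.kerLift_injective f
  have hS : Function.Injective (algebraMap (R ⧸ RingHom.ker f) (S ⧸ q)) :=
    Ideal.quotientMap_injective' h.le
  have : Algebra.FiniteType (R ⧸ RingHom.ker f) (S ⧸ q) := by
    have h1 : ((Ideal.Quotient.mk q).comp (algebraMap R S)).FiniteType :=
      RingHom.FiniteType.comp (RingHom.FiniteType.of_surjective _ Ideal.Quotient.mk_surjective)
        (RingHom.finiteType_algebraMap.mpr inferInstance)
    rw [← htoQ] at h1
    exact RingHom.FiniteType.of_comp_finiteType h1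
  -- Both factors contain the domain `R ⧸ ker f`, so the base change to `K` is a nonzero `K`-algebra
  -- of finite type, to which the Nullstellensatz applies.
  have : Nontrivial (K ⊗[R ⧸ RingHom.ker f] (S ⧸ q)) :=
    Algebra.TensorProduct.nontrivial_of_algebraMap_injective_of_isDomain _ _ _ hK hS
  obtain ⟨ψ⟩ := Algebra.FiniteType.nonempty_algHom_algebraicClosure K
    (K ⊗[R ⧸ RingHom.ker f] (S ⧸ q))
  let χ : S ⧸ q →+* K ⊗[R ⧸ RingHom.ker f] (S ⧸ q) :=
    (Algebra.TensorProduct.includeRight : S ⧸ q →ₐ[R ⧸ RingHom.ker f] _).toRingHom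
  refine ⟨(ψ.toRingHom.comp χ).comp (Ideal.Quotient.mk q), ?_⟩
  ext r
  have h1 : χ (Ideal.Quotient.mk q (algebraMap R S r)) =
      algebraMap K (K ⊗[R ⧸ RingHom.ker f] (S ⧸ q)) (f r) :=
    (AlgHom.commutes Algebra.TensorProduct.includeRight
      (Ideal.Quotient.mk (RingHom.ker f) r)).trans
      (IsScalarTower.algebraMap_apply (R ⧸ RingHom.ker f) K _ (Ideal.Quotient.mk _ r))
  change ψ (χ (Ideal.Quotient.mk q (algebraMap R S r))) = _
  rw [h1]
  exact ψ.commutes (f r)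

/-! ### Thickness in terms of matrices. -/

namespace Representation

open Matrix

variable {K G V ι α β : Type*} [Field K] [Group G] [AddCommGroup V] [Module K V]
  [Fintype ι] [DecidableEq ι] [Fintype α] [DecidableEq α] [Fintype β] [DecidableEq β]

theorem _root_.Matrix.exists_mul_eq_one_iff_linearIndependent (b : Module.Basis ι K V) (v : α → V) :
    (∃ C : Matrix α ι K, C * b.toMatrix v = 1) ↔ LinearIndependent K v := by
  have h : (b.toMatrix v).col = b.equivFun ∘ v := rfl
  have h2 : LinearIndependent K (b.toMatrix v).col ↔ LinearIndependent K v := by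
    rw [h]
    exact LinearMap.linearIndependent_iff b.equivFun.toLinearMap (LinearEquiv.ker _)
  rw [← h2]
  constructor
  · rintro ⟨C, hC⟩
    rw [← mulVec_injective_iff]
    intro x y hxy
    simpa [hC] using congr_arg (C *ᵥ ·) hxy
  · intro hli
    obtain ⟨g, hg⟩ := (b.toMatrix v).mulVecLin.exists_leftInverse_of_injective
      (LinearMap.ker_eq_bot.mpr (mulVec_injective_iff.mpr hli))
    refine ⟨LinearMap.toMatrix' g, ?_⟩
    have := congr_arg LinearMap.toMatrix' hg
    rwa [LinearMap.toMatrix'_comp, LinearMap.toMatrix'_id, ← Matrix.toLin'_apply',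
      LinearMap.toMatrix'_toLin'] at this

/-- The determinant is that of the joint family `f ∘ v`, `w` in the basis `b`. It is nonzero iff
this family is a basis, that is, iff the two spans are disjoint and together span `V`. -/
theorem isCompl_span_iff_pairingDet_ne_zero (e : α ⊕ β ≃ ι) (b : Module.Basis ι K V)
    {f : V →ₗ[K] V} (hf : Function.Injective f) {v : α → V} {w : β → V}
    (hv : LinearIndependent K v) (hw : LinearIndependent K w) :
    IsCompl ((Submodule.span K (Set.range v)).map f) (Submodule.span K (Set.range w)) ↔
      pairingDet e (LinearMap.toMatrix b b f) (b.toMatrix v) (b.toMatrix w) ≠ 0 := by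
  have h1 : pairingDet e (LinearMap.toMatrix b b f) (b.toMatrix v) (b.toMatrix w) =
      (b.reindex e.symm).det (Sum.elim (f ∘ v) w) := by
    have h2 : LinearMap.toMatrix b b f * b.toMatrix v = b.toMatrix (f ∘ v) := by
      ext i j
      exact congr_fun (LinearMap.toMatrix_mulVec_repr b b f (v j)) i
    rw [pairingDet, h2, Module.Basis.det_apply]
    congr 1
    ext i (j | j) <;> simp [Module.Basis.toMatrix_apply]
  have hfv : LinearIndependent K (f ∘ v) := hv.map' f (LinearMap.ker_eq_bot.mpr hf)
  rw [h1, ← isUnit_iff_ne_zero, ← Module.Basis.is_basis_iff_det, linearIndependent_sum,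
    Sum.elim_comp_inl, Sum.elim_comp_inr, Set.Sum.elim_range, Submodule.span_union,
    Submodule.map_span, ← Set.range_comp, isCompl_iff, codisjoint_iff]
  simp [hfv, hw]

theorem isMThick_iff_not_isObstructed [FiniteDimensional K V] (ρ : Representation K G V)
    (e : α ⊕ β ≃ ι) (b : Module.Basis ι K V) :
    ρ.IsMThick (Fintype.card α) ↔ ¬ IsObstructed e fun g => LinearMap.toMatrix b b (ρ g) := by
  have hρ : ∀ g, Function.Injective (ρ g) := fun g => by
    refine Function.LeftInverse.injective (g := ρ g⁻¹) fun x => ?_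
    rw [← Module.End.mul_apply, ← map_mul, inv_mul_cancel, map_one, Module.End.one_apply]
  have hcard : Module.finrank K V = Fintype.card α + Fintype.card β := by
    rw [Module.finrank_eq_card_basis b, ← Fintype.card_congr e, Fintype.card_sum]
  constructor
  · rintro h ⟨A, C, B, D, hA, hB, hdet⟩
    have hA' : b.toMatrix (fun j => b.equivFun.symm (A.col j)) = A := by
      ext i j
      rw [Module.Basis.toMatrix_apply, ← Module.Basis.equivFun_apply, LinearEquiv.apply_symm_apply,
        col_apply]
    have hB' : b.toMatrix (fun j => b.equivFun.symm (B.col j)) = B := by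
      ext i j
      rw [Module.Basis.toMatrix_apply, ← Module.Basis.equivFun_apply, LinearEquiv.apply_symm_apply,
        col_apply]
    generalize (fun j => b.equivFun.symm (A.col j)) = v at hA'
    generalize (fun j => b.equivFun.symm (B.col j)) = w at hB'
    subst hA' hB'
    have hv := (Matrix.exists_mul_eq_one_iff_linearIndependent b v).mp ⟨C, hA⟩
    have hw := (Matrix.exists_mul_eq_one_iff_linearIndependent b w).mp ⟨D, hB⟩
    obtain ⟨g, hg⟩ := h _ _ (finrank_span_eq_card hv) (by rw [finrank_span_eq_card hw, hcard])
    exact (isCompl_span_iff_pairingDet_ne_zero e b (hρ g) hv hw).mp hg (hdet g)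
  · intro h V₁ V₂ h₁ h₂
    rw [hcard, add_right_inj] at h₂
    let v := Module.finBasisOfFinrankEq K V₁ h₁ |>.reindex (Fintype.equivFin α).symm
    let w := Module.finBasisOfFinrankEq K V₂ h₂ |>.reindex (Fintype.equivFin β).symm
    have hv : LinearIndependent K (V₁.subtype ∘ v) :=
      v.linearIndependent.map' _ V₁.ker_subtype
    have hw : LinearIndependent K (V₂.subtype ∘ w) :=
      w.linearIndependent.map' _ V₂.ker_subtype
    have hV₁ : Submodule.span K (Set.range (V₁.subtype ∘ v)) = V₁ := by
      rw [Set.range_comp, ← Submodule.map_span, v.span_eq, Submodule.map_top,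
        Submodule.range_subtype]
    have hV₂ : Submodule.span K (Set.range (V₂.subtype ∘ w)) = V₂ := by
      rw [Set.range_comp, ← Submodule.map_span, w.span_eq, Submodule.map_top,
        Submodule.range_subtype]
    obtain ⟨C, hC⟩ := (Matrix.exists_mul_eq_one_iff_linearIndependent b _).mpr hv
    obtain ⟨D, hD⟩ := (Matrix.exists_mul_eq_one_iff_linearIndependent b _).mpr hw
    by_contra! hg
    refine h ⟨_, C, _, D, hC, hD, fun g => ?_⟩
    by_contra hne
    rw [← Ne, ← isCompl_span_iff_pairingDet_ne_zero e b (hρ g) hv hw, hV₁, hV₂] at hne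
    exact hg g hne

theorem isAbsMThick_iff_not_isObstructed [FiniteDimensional K V] (ρ : Representation K G V)
    (e : α ⊕ β ≃ ι) (b : Module.Basis ι K V) :
    ρ.IsAbsMThick (Fintype.card α) ↔ ¬ IsObstructed e fun g =>
      (LinearMap.toMatrix b b (ρ g)).map (algebraMap K (AlgebraicClosure K)) := by
  rw [IsAbsMThick, isMThick_iff_not_isObstructed _ e
    (Algebra.TensorProduct.basis (AlgebraicClosure K) b)]
  simp only [← LinearMap.toMatrix_baseChange]
  rfl

end Representation

/-! ### Closedness of the obstructed locus. -/

noncomputable section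

/-- A prime ideal that contains the kernel of a ring homomorphism to a field is the center of a
valuation ring of that field. -/
theorem ValuationSubring.exists_ker_residue_comp_eq {R L : Type*} [CommRing R] [Field L]
    (f : R →+* L) (y : Ideal R) [y.IsPrime] (hy : RingHom.ker f ≤ y) :
    ∃ (O : ValuationSubring L) (h : R →+* O),
      O.subtype.comp h = f ∧ RingHom.ker ((IsLocalRing.residue O).comp h) = y := by
  have hf : ∀ s : y.primeCompl, IsUnit (f s) := fun s =>
    isUnit_iff_ne_zero.mpr fun h0 => s.2 (hy h0)
  let φ : Localization.AtPrime y →+* L := IsLocalization.lift hf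
  -- A valuation ring dominating the image of the local ring at `y`; locality of the map makes its
  -- center exactly `y`.
  obtain ⟨O, hO, hloc⟩ := IsLocalRing.exists_factor_valuationRing φ
  let ψ : Localization.AtPrime y →+* O := φ.codRestrict O.toSubring hO
  have hψ : IsLocalHom ψ := hloc
  refine ⟨O, ψ.comp (algebraMap R _), RingHom.ext fun r => IsLocalization.lift_eq hf r, ?_⟩
  ext r
  rw [RingHom.mem_ker, RingHom.comp_apply, RingHom.comp_apply, IsLocalRing.residue_eq_zero_iff,
    IsLocalRing.mem_maximalIdeal, _root_.mem_nonunits_iff, isUnit_map_iff,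
    IsLocalization.AtPrime.isUnit_to_map_iff _ y]
  exact not_not

namespace Matrix

variable {ι α β G : Type*} [Fintype ι] [Fintype α] [DecidableEq α]
  [Fintype β] [DecidableEq β] {R : Type*} [CommRing R]

/-- The points of `Spec R` at which a family of matrices becomes obstructed over an extension of
the residue field form a closed subset. -/
theorem isClosed_range_comap_obstructionRing (e : α ⊕ β ≃ ι) (M : G → Matrix ι ι R) :
    IsClosed (Set.range (PrimeSpectrum.comap (algebraMap R (ObstructionRing e M)))) := by
  -- This criterion needs no finite presentation, so the possibly infinitely many equations, one for
  -- each `g`, do no harm.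
  refine PrimeSpectrum.isClosed_range_of_stableUnderSpecialization _ ?_
  rintro _ y hxy ⟨q, rfl⟩
  rw [← PrimeSpectrum.le_iff_specializes] at hxy
  have hker : RingHom.ker ((algebraMap (ObstructionRing e M) q.asIdeal.ResidueField).comp
      (algebraMap R (ObstructionRing e M))) ≤ y.asIdeal := fun r hr =>
    hxy ((Ideal.algebraMap_residueField_eq_zero (I := q.asIdeal)).mp hr)
  obtain ⟨O, h, hh, hy⟩ := ValuationSubring.exists_ker_residue_comp_eq _ _ hker
  have hL : IsObstructed e fun g => (M g).map (O.subtype.comp h) :=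
    (isObstructed_map_iff e M _).mpr ⟨_, hh.symm⟩
  have hobs : IsObstructed e fun g => (M g).map h := isObstructed_valuationSubring O hL
  have hres : IsObstructed e fun g => (M g).map ((IsLocalRing.residue O).comp h) := 
    hobs.map (IsLocalRing.residue O)
  obtain ⟨χ, hχ⟩ := (isObstructed_map_iff e M _).mp hres
  -- The kernel of the point `χ` over the residue field of `O` is a prime lying over `y`.
  refine ⟨PrimeSpectrum.comap χ ⊥, ?_⟩
  rw [← PrimeSpectrum.comap_comp_apply, hχ]
  exact PrimeSpectrum.ext hy

theorem mem_range_comap_obstructionRing_iff (e : α ⊕ β ≃ ι) (M : G → Matrix ι ι R)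
    {K : Type*} [Field K] (f : R →+* K) (x : PrimeSpectrum R) (hx : RingHom.ker f = x.asIdeal) :
    x ∈ Set.range (PrimeSpectrum.comap (algebraMap R (ObstructionRing e M))) ↔
      IsObstructed e fun g => ((M g).map f).map (algebraMap K (AlgebraicClosure K)) := by
  have h1 : (fun g => ((M g).map f).map (algebraMap K (AlgebraicClosure K))) =
      fun g => (M g).map ((algebraMap K (AlgebraicClosure K)).comp f) := by
    simp only [Matrix.map_map, RingHom.coe_comp]
  rw [h1, isObstructed_map_iff]
  constructor
  · rintro ⟨q, rfl⟩
    exact RingHom.exists_comp_eq_algebraicClosure f q.asIdeal hx.symm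
  · rintro ⟨φ, hφ⟩
    refine ⟨PrimeSpectrum.comap φ ⊥, ?_⟩
    rw [← PrimeSpectrum.comap_comp_apply, hφ]
    ext r
    rw [← hx]
    change algebraMap K (AlgebraicClosure K) (f r) ∈ (⊥ : Ideal _) ↔ f r = 0
    rw [Ideal.mem_bot, map_eq_zero]

end Matrix

/-! ### Application to the universal representation. -/

namespace RepScheme

variable (n : ℕ) (G : Type u) [Group G]

/-- The evaluation of the coordinate ring of `Rep_n(G)` at a point. -/
def evalAt (x : RepScheme n G) : coordRing n G →+* (RepScheme n G).residueField x :=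
  ((RepScheme n G).Γevaluation x).hom.comp
    (Scheme.ΓSpecIso (CommRingCat.of (coordRing n G))).inv.hom

theorem ker_evalAt (x : RepScheme n G) : RingHom.ker (evalAt n G x) = x.asIdeal := by
  ext r
  rw [RingHom.mem_ker]
  refine (Scheme.evaluation_eq_zero_iff_notMem_basicOpen _ x (TopologicalSpace.Opens.mem_top x) _).trans ?_
  change ¬ x ∈ (Spec (CommRingCat.of (coordRing n G))).basicOpen
    ((Scheme.ΓSpecIso (CommRingCat.of (coordRing n G))).inv r) ↔ _
  rw [basicOpen_eq_of_affine]
  exact not_not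

theorem toMatrix_fibre_universal (x : RepScheme n G) (g : G) :
    LinearMap.toMatrix (Pi.basisFun _ _) (Pi.basisFun _ _) (fibre (universal n G) x g) =
      (universalMatrix n G g).map (evalAt n G x) := by
  rw [LinearMap.toMatrix_eq_toMatrix']
  exact LinearMap.toMatrix'_toLin' _

theorem exists_opens_isAbsMThick (m : ℕ) (hm : m ≤ n) :
    ∃ U : (RepScheme n G).Opens, ∀ x : RepScheme n G,
      x ∈ U ↔ (fibre (universal n G) x).IsAbsMThick m := by
  obtain ⟨k, rfl⟩ := Nat.exists_eq_add_of_le hm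
  let e : Fin m ⊕ Fin k ≃ Fin (m + k) := finSumFinEquiv
  refine ⟨⟨(Set.range (PrimeSpectrum.comap (algebraMap (coordRing (m + k) G)
    (Matrix.ObstructionRing e (universalMatrix (m + k) G)))))ᶜ,
    (Matrix.isClosed_range_comap_obstructionRing e _).isOpen_compl⟩, fun x => ?_⟩
  have h1 := Representation.isAbsMThick_iff_not_isObstructed (fibre (universal (m + k) G) x) e
    (Pi.basisFun _ _)
  rw [Fintype.card_fin] at h1
  rw [h1]
  simp only [toMatrix_fibre_universal]
  rw [← Matrix.mem_range_comap_obstructionRing_iff e _ (evalAt (m + k) G x) x (ker_evalAt _ G x)]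
  rfl

end RepScheme

end

/-- The absolutely `m`-thick representations form an open subscheme of `Rep_n(G)`, and so do the
absolutely thick ones. -/
theorem theorem3 (n : ℕ) (G : Type u) [Group G] :
    (∀ m : ℕ, 0 < m → m < n →
      ∃ U : (RepScheme n G).Opens, ∀ x : RepScheme n G,
        x ∈ U ↔ (RepScheme.fibre (RepScheme.universal n G) x).IsAbsMThick m) ∧
    (∃ U : (RepScheme n G).Opens, ∀ x : RepScheme n G,
        x ∈ U ↔ (RepScheme.fibre (RepScheme.universal n G) x).IsAbsThick) := by
  have h : ∀ m : Fin n, ∃ U : (RepScheme n G).Opens, ∀ x : RepScheme n G,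
      x ∈ U ↔ (RepScheme.fibre (RepScheme.universal n G) x).IsAbsMThick m :=
    fun m => RepScheme.exists_opens_isAbsMThick n G m m.2.le
  refine ⟨fun m _ hm => h ⟨m, hm⟩, ?_⟩
  choose U hU using h
  -- Only the finitely many `m` with `0 < m < n` occur, so the intersection is open.
  refine ⟨⟨⋂ m : {m : Fin n // 0 < (m : ℕ)}, (U m : Set (RepScheme n G)),
    isOpen_iInter_of_finite fun m => (U m).isOpen⟩, fun x => ?_⟩
  change x ∈ ⋂ m : {m : Fin n // 0 < (m : ℕ)}, (U m : Set (RepScheme n G)) ↔ _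
  rw [Set.mem_iInter, Representation.IsAbsThick, Module.finrank_fin_fun]
  exact ⟨fun hx m h0 hm => (hU ⟨m, hm⟩ x).mp (hx ⟨⟨m, hm⟩, h0⟩),
    fun hx m => (hU m x).mpr (hx m m.2 m.1.2)⟩
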